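/- Let $n\ge 4$, let $F_n$ be a free group of rank $n$ with basis $\{a_1,\dots,a_n\}$, and for $i\ne j$ let $\lambda_{ij},\rho_{ij}\in\mathrm{Aut}(F_n)$ be the left and right Nielsen transformations, given by $\lambda_{ij}(a_i)=a_ja_i$, $\rho_{ij}(a_i)=a_ia_j$, and $\lambda_{ij}(a_k)=\rho_{ij}(a_k)=a_k$ for $k\ne i$. Suppose that $\mathrm{Aut}(F_n)$ acts by semisimple isometries on a complete $\mathrm{CAT}(0)$ space $X$; that is, every $\gamma\in\mathrm{Aut}(F_n)$ acts as an isometry of $X$ for which the infimum $\inf_{x\in X} d(x,\gamma x)$ is attained at some point of $X$. Then each Nielsen transformation $\lambda_{ij}$ and $\rho_{ij}$ ($i\ne j$) fixes a point of $X$. -/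

import Mathlib

universe u v

section CAT0

variable {X : Type u} [MetricSpace X]

/-- `S` is a geodesic segment from `x` to `y`: the image of an isometric embedding of the interval
`[0, dist x y]` into `X` that takes the endpoints to `x` and `y`. -/
def IsGeodesicSegment (x y : X) (S : Set X) : Prop :=
  ∃ c : ℝ → X, c 0 = x ∧ c (dist x y) = y ∧
    (∀ s ∈ Set.Icc 0 (dist x y), ∀ t ∈ Set.Icc 0 (dist x y), dist (c s) (c t) = |s - t|) ∧
    S = c '' Set.Icc 0 (dist x y)

variable (X) in
/-- A `CAT(0)` space: a geodesic metric space in which every geodesic triangle is at least as thin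
as its comparison triangle in the Euclidean plane. The triangle has vertices `v 0`, `v 1`, `v 2`
and its side `side i` joins `v i` to `v (i + 1)` (indices mod 3); `v' 0`, `v' 1`, `v' 2` are the
vertices of a comparison triangle, and `x'` is the comparison point of `x ∈ side i`, that is, the
point on the segment from `v' i` to `v' (i + 1)` with `dist (v' i) x' = dist (v i) x`. -/
structure IsCAT0 : Prop where
  geodesic : ∀ x y : X, ∃ S : Set X, IsGeodesicSegment x y S
  comparison : ∀ (v : Fin 3 → X) (side : Fin 3 → Set X),
    (∀ i, IsGeodesicSegment (v i) (v (i + 1)) (side i)) →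
    ∀ v' : Fin 3 → EuclideanSpace ℝ (Fin 2), (∀ i j, dist (v' i) (v' j) = dist (v i) (v j)) →
    ∀ i j, ∀ x ∈ side i, ∀ y ∈ side j,
    ∀ x' ∈ segment ℝ (v' i) (v' (i + 1)), ∀ y' ∈ segment ℝ (v' j) (v' (j + 1)),
    dist (v' i) x' = dist (v i) x → dist (v' j) y' = dist (v j) y → dist x y ≤ dist x' y'

/-- The translation length `inf {d(x, γ x) | x ∈ X}`. -/
noncomputable def translationLength (γ : X → X) : ℝ := ⨅ x, dist x (γ x)

/-- `Min(γ)`, the set of points at which the displacement of `γ` attains its infimum. -/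
def minSet (γ : X → X) : Set X := {x | dist x (γ x) = translationLength γ}

/-- An isometry `γ` is semisimple if `Min(γ)` is non-empty. -/
def IsSemisimpleIsometry (γ : X → X) : Prop := Isometry γ ∧ (minSet γ).Nonempty

/-- The group `G` acts on `X` by semisimple isometries. -/
def ActsBySemisimpleIsometries (G : Type v) [Group G] (X : Type u) [MetricSpace X]
    [MulAction G X] : Prop :=
  ∀ g : G, IsSemisimpleIsometry (fun x : X => g • x)

end CAT0

section Nielsen

variable {ι : Type u} [DecidableEq ι] {F : Type v} [Group F]

/-- The left Nielsen transformation `λ_ij`, with respect to a basis `b` of the free group `F`: it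
sends `b i` to `b j * b i` and fixes `b k` for `k ≠ i`. -/
noncomputable def leftNielsen (b : FreeGroupBasis ι F) (i j : ι) (hij : i ≠ j) : MulAut F :=
  MonoidHom.toMulEquiv
    (b.lift (Function.update b i (b j * b i)))
    (b.lift (Function.update b i ((b j)⁻¹ * b i)))
    (by
      refine b.ext_hom _ _ fun k => ?_
      rcases eq_or_ne k i with rfl | hk
      · simp [hij.symm]
      · simp [hk])
    (by
      refine b.ext_hom _ _ fun k => ?_
      rcases eq_or_ne k i with rfl | hk
      · simp [hij.symm]
      · simp [hk])

/-- The right Nielsen transformation `ρ_ij`, with respect to a basis `b` of the free group `F`: it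
sends `b i` to `b i * b j` and fixes `b k` for `k ≠ i`. -/
noncomputable def rightNielsen (b : FreeGroupBasis ι F) (i j : ι) (hij : i ≠ j) : MulAut F :=
  MonoidHom.toMulEquiv
    (b.lift (Function.update b i (b i * b j)))
    (b.lift (Function.update b i (b i * (b j)⁻¹)))
    (by
      refine b.ext_hom _ _ fun k => ?_
      rcases eq_or_ne k i with rfl | hk
      · simp [hij.symm]
      · simp [hk])
    (by
      refine b.ext_hom _ _ fun k => ?_
      rcases eq_or_ne k i with rfl | hk
      · simp [hij.symm]
      · simp [hk])

end Nielsen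

/-!
Let `γ` be the Nielsen transformation `λ_ij` and `|g|` the translation length of `g`. Choose `k` and
`l` distinct from each other and from `i` and `j`; this is where `n ≥ 4` enters. Let `δ = ρ_kj`.
These facts about `Aut F_n` are used:

* `δ` commutes with `γ`, and is in fact a commutator of `ρ_kl` and `ρ_lj`, which both centralize `γ`
  (`commute_leftNielsen_rightNielsen`, `rightNielsen_mul_rightNielsen`);
* `γ⁻¹ * δ` is conjugate to `δ`, by `λ_ik` (`leftNielsen_mul_leftNielsen_mul_rightNielsen`).

Suppose `|γ| > 0`. Then `γ` translates axes. A homomorphism from its centralizer to `ℝ` measures the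
translation along these axes, and it kills the commutator `δ`. So `δ` moves orthogonally to `γ`,
which gives `|γ⁻¹ * δ| ^ 2 = |γ| ^ 2 + |δ| ^ 2 > |δ| ^ 2`, although `γ⁻¹ * δ` and `δ` are conjugate.
Hence `|γ| = 0`, and as `γ` is semisimple it has a fixed point. The case of `ρ_ij` is the mirror
image.

No splitting theorem is needed for the geometry. Everything comes from the Bruhat-Tits inequality
`SatisfiesCN`, through its consequence `SatisfiesCN.quadrilateral`. Translation lengths are
asymptotic displacements (`tendsto_dist_pow_smul`), so the quadrilateral inequality for large
quadrilaterals makes `|·| ^ 2` satisfy the parallelogram law on commuting elements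
(`Commute.translationLength_parallelogram`). The translation along the axes is the limit
`busemannCocycle γ p h` of `dist p ((γ ^ N * h) • p) - N * |γ|`. It is subadditive on the
centralizer, and the quadrilateral inequality bounds the sum of its values at `h` and `h⁻¹` by `0`;
so it is nonpositive on commutators. On the other hand `|γ⁻¹ * δ| = |δ|` and the parallelogram law
give `|γ ^ N * δ| ^ 2 = |δ| ^ 2 + (N ^ 2 + N) * |γ| ^ 2`, so that `|γ ^ N * δ| - N * |γ|` tends to
`|γ| / 2`, a contradiction (`exists_smul_eq_of_commutator_of_conj`).
-/

/-! ### The inequality of Bruhat and Tits -/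

/-- The inequality of Bruhat and Tits: any two points have a midpoint `m` whose distance to a third
point `z` is at most the length of the median in a Euclidean triangle. The case `z = x` or `z = y`
forces `m` to be a midpoint. -/
def SatisfiesCN (X : Type*) [MetricSpace X] : Prop :=
  ∀ x y : X, ∃ m : X, ∀ z : X,
    dist z m ^ 2 ≤ (dist z x ^ 2 + dist z y ^ 2) / 2 - dist x y ^ 2 / 4

theorem exists_comparison_triangle {X : Type*} [MetricSpace X] (v : Fin 3 → X) :
    ∃ v' : Fin 3 → EuclideanSpace ℝ (Fin 2), ∀ i j, dist (v' i) (v' j) = dist (v i) (v j) := by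
  suffices h : ∃ x y z : EuclideanSpace ℝ (Fin 2), dist x y = dist (v 0) (v 1) ∧
      dist y z = dist (v 1) (v 2) ∧ dist x z = dist (v 0) (v 2) by
    obtain ⟨x, y, z, h₁, h₂, h₃⟩ := h
    refine ⟨![x, y, z], fun i j => ?_⟩
    fin_cases i <;> fin_cases j <;> simp [h₁, h₂, h₃, dist_comm y x, dist_comm z y, dist_comm z x,
      dist_comm (v 1) (v 0), dist_comm (v 2) (v 0), dist_comm (v 2) (v 1)]
  have t₁ := dist_triangle (v 0) (v 1) (v 2)
  have t₂ := dist_triangle (v 1) (v 0) (v 2)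
  have t₃ := dist_triangle_right (v 0) (v 1) (v 2)
  rw [dist_comm (v 1) (v 0)] at t₂
  have ha : 0 ≤ dist (v 0) (v 1) := dist_nonneg
  have hb : 0 ≤ dist (v 1) (v 2) := dist_nonneg
  have hc : 0 ≤ dist (v 0) (v 2) := dist_nonneg
  generalize dist (v 0) (v 1) = a at *
  generalize dist (v 1) (v 2) = b at *
  generalize dist (v 0) (v 2) = c at *
  rcases ha.eq_or_lt with rfl | ha'
  · refine ⟨!₂[0, 0], !₂[0, 0], !₂[c, 0], by simp, ?_, ?_⟩ <;>
      simp [EuclideanSpace.dist_eq, Real.sqrt_sq_eq_abs, abs_of_nonneg hc]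
    linarith
  · obtain ⟨u, hu⟩ : ∃ u, 2 * a * u = a ^ 2 + c ^ 2 - b ^ 2 :=
      ⟨(a ^ 2 + c ^ 2 - b ^ 2) / (2 * a), by field_simp⟩
    have hu₁ : u ≤ c := by nlinarith
    have hu₂ : -c ≤ u := by nlinarith
    have hw : √(c ^ 2 - u ^ 2) ^ 2 = c ^ 2 - u ^ 2 := Real.sq_sqrt (by nlinarith)
    refine ⟨!₂[0, 0], !₂[a, 0], !₂[u, √(c ^ 2 - u ^ 2)], ?_, ?_, ?_⟩
    · simp [EuclideanSpace.dist_eq, Real.sqrt_sq_eq_abs, abs_of_nonneg ha]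
    · rw [EuclideanSpace.dist_eq, Real.sqrt_eq_iff_mul_self_eq (by positivity) hb]
      simp [Real.dist_eq, sq_abs, hw]
      linarith
    · rw [EuclideanSpace.dist_eq, Real.sqrt_eq_iff_mul_self_eq (by positivity) hc]
      simp [Real.dist_eq, sq_abs, hw]
      ring

theorem IsCAT0.satisfiesCN {X : Type*} [MetricSpace X] (hX : IsCAT0 X) : SatisfiesCN X := by
  intro x y
  obtain ⟨S, hS⟩ := hX.geodesic x y
  obtain ⟨c, hc₀, hc₁, hc, hSc⟩ := id hS
  have hd : 0 ≤ dist x y := dist_nonneg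
  refine ⟨c (dist x y / 2), fun z => ?_⟩
  obtain ⟨T, hT⟩ := hX.geodesic y z
  obtain ⟨U, hU⟩ := hX.geodesic z x
  obtain ⟨v', hv'⟩ := exists_comparison_triangle ![x, y, z]
  have h01 : dist (v' 0) (v' 1) = dist x y := by simpa using hv' 0 1
  have h20 : dist (v' 2) (v' 0) = dist z x := by simpa using hv' 2 0
  have h21 : dist (v' 2) (v' 1) = dist z y := by simpa using hv' 2 1
  have hm : dist x (c (dist x y / 2)) = dist x y / 2 := by
    have := hc 0 ⟨le_rfl, hd⟩ (dist x y / 2) ⟨by linarith, by linarith⟩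
    rwa [hc₀, zero_sub, abs_neg, abs_of_nonneg (by linarith)] at this
  have hzU : z ∈ U := by
    obtain ⟨e, he₀, -, -, rfl⟩ := hU
    exact ⟨0, ⟨le_rfl, dist_nonneg⟩, he₀⟩
  have key := hX.comparison ![x, y, z] ![S, T, U]
    (by intro i; fin_cases i <;> simpa) v' hv' 2 0 z (by simpa) (c (dist x y / 2))
    (by rw [show (![S, T, U] : Fin 3 → Set X) 0 = S from rfl, hSc]
        exact ⟨_, ⟨by linarith, by linarith⟩, rfl⟩)
    (v' 2) (left_mem_segment _ _ _) (midpoint ℝ (v' 0) (v' 1)) (midpoint_mem_segment _ _)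
    (by simp) (by simp [dist_left_midpoint, h01, hm]; ring)
  have hE := EuclideanGeometry.dist_sq_add_dist_sq_eq_two_mul_dist_midpoint_sq_add_half_dist_sq
    (v' 2) (v' 0) (v' 1)
  rw [h01, h20, h21] at hE
  have := pow_le_pow_left₀ dist_nonneg key 2
  linarith

theorem SatisfiesCN.quadrilateral {X : Type*} [MetricSpace X] (hX : SatisfiesCN X) (x y z w : X) :
    dist x z ^ 2 + dist y w ^ 2 ≤
      dist x y ^ 2 + dist y z ^ 2 + dist z w ^ 2 + dist w x ^ 2 := by
  obtain ⟨m, hm⟩ := hX x z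
  have h₁ := hm y
  have h₂ := hm w
  have h₃ := dist_triangle_right y w m
  rw [dist_comm y x] at h₁
  rw [dist_comm w z] at h₂
  nlinarith [sq_nonneg (dist y m - dist w m), dist_nonneg (x := y) (y := w)]

/-! ### Translation lengths and the parallelogram law -/

section TranslationLength

variable {G : Type*} [Group G] {X : Type*} [MetricSpace X] [MulAction G X]

theorem translationLength_le (g : G) (x : X) :
    translationLength (fun x : X => g • x) ≤ dist x (g • x) :=
  ciInf_le ⟨0, by rintro _ ⟨y, rfl⟩; exact dist_nonneg⟩ x

theorem translationLength_nonneg (g : G) : 0 ≤ translationLength (fun x : X => g • x) :=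
  Real.iInf_nonneg fun _ => dist_nonneg

theorem translationLength_inv (g : G) :
    translationLength (fun x : X => g⁻¹ • x) = translationLength (fun x : X => g • x) := by
  refine ((MulAction.toPerm g).iInf_congr fun x => ?_).symm
  simp [dist_comm]

variable [IsIsometricSMul G X]

theorem dist_pow_smul_le (g : G) (x : X) (n : ℕ) : dist x (g ^ n • x) ≤ n * dist x (g • x) := by
  induction n with
  | zero => simp
  | succ n ih =>
    have := dist_triangle x (g ^ n • x) (g ^ (n + 1) • x)
    rw [pow_succ, mul_smul, dist_smul] at this
    rw [pow_succ, mul_smul]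
    push_cast
    linarith

theorem translationLength_conj (s g : G) :
    translationLength (fun x : X => (s * g * s⁻¹) • x) =
      translationLength (fun x : X => g • x) := by
  refine ((MulAction.toPerm s).iInf_congr fun x => ?_).symm
  simp [mul_smul]

variable [Nonempty X]

/-- If `m` is the midpoint of `x` and `g • x`, then the distance from `m` to `g • m`, the midpoint
of `g • x` and `g ^ 2 • x`, is at most half that from `x` to `g ^ 2 • x`. -/
theorem two_mul_translationLength_le (hX : SatisfiesCN X) (g : G) :
    2 * translationLength (fun x : X => g • x) ≤ translationLength (fun x : X => g ^ 2 • x) := by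
  refine le_ciInf fun x => ?_
  obtain ⟨m, hm⟩ := hX x (g • x)
  have h₁ := hm (g • x)
  have h₂ := hm (g ^ 2 • x)
  have h₃ := hm (g⁻¹ • m)
  have h₄ : dist (g⁻¹ • m) x = dist m (g • x) := by rw [← dist_smul g]; simp
  have h₅ : dist (g⁻¹ • m) (g • x) = dist m (g ^ 2 • x) := by
    rw [← dist_smul g]; simp [pow_two, mul_smul]
  have h₆ : dist (g⁻¹ • m) m = dist m (g • m) := by rw [← dist_smul g]; simp
  have h₇ : dist (g ^ 2 • x) (g • x) = dist x (g • x) := by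
    rw [pow_two, mul_smul, dist_smul, dist_comm]
  rw [h₄, h₅, h₆] at h₃
  rw [h₇] at h₂
  rw [dist_self, dist_comm (g • x) x] at h₁
  rw [dist_comm m (g • x), dist_comm m (g ^ 2 • x)] at h₃
  rw [dist_comm (g ^ 2 • x) x] at h₂
  have : dist m (g • m) ≤ dist x (g ^ 2 • x) / 2 :=
    abs_le_of_sq_le_sq' (by nlinarith) (by positivity) |>.2
  linarith [translationLength_le g m]

theorem two_pow_mul_translationLength_le (hX : SatisfiesCN X) (g : G) (k : ℕ) :
    2 ^ k * translationLength (fun x : X => g • x) ≤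
      translationLength (fun x : X => g ^ 2 ^ k • x) := by
  induction k with
  | zero => simp
  | succ k ih =>
    have := two_mul_translationLength_le hX (g ^ 2 ^ k)
    rw [← pow_mul, ← pow_succ] at this
    rw [pow_succ]
    linarith

/-- In a `CAT(0)` space the translation length of any isometry, semisimple or not, is its
asymptotic displacement. -/
theorem tendsto_dist_pow_smul (hX : SatisfiesCN X) (g : G) (x : X) :
    Filter.Tendsto (fun k : ℕ => dist x (g ^ 2 ^ k • x) / 2 ^ k) Filter.atTop
      (nhds (translationLength (fun x : X => g • x))) := by
  refine tendsto_order.2 ⟨fun a ha => Filter.Eventually.of_forall fun k => ?_, fun a ha => ?_⟩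
  · rw [lt_div_iff₀ (by positivity)]
    have h₁ := two_pow_mul_translationLength_le hX g k
    have h₂ := translationLength_le (g ^ 2 ^ k) x
    have h₃ : a * 2 ^ k < translationLength (fun x : X => g • x) * 2 ^ k := by gcongr
    linarith
  · obtain ⟨y, hy⟩ := exists_lt_of_ciInf_lt ha
    have hlim : Filter.Tendsto (fun k : ℕ => dist y (g • y) + 2 * dist x y / 2 ^ k) Filter.atTop
        (nhds (dist y (g • y) + 0)) :=
      tendsto_const_nhds.add
        (tendsto_const_nhds.div_atTop (tendsto_pow_atTop_atTop_of_one_lt one_lt_two))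
    rw [add_zero] at hlim
    filter_upwards [hlim.eventually_lt_const hy] with k hk
    refine lt_of_le_of_lt ?_ hk
    have h₁ := dist_triangle4 x y (g ^ 2 ^ k • y) (g ^ 2 ^ k • x)
    have h₂ := dist_pow_smul_le g y (2 ^ k)
    rw [dist_smul, dist_comm y x] at h₁
    push_cast at h₂
    rw [div_le_iff₀ (by positivity), add_mul, div_mul_cancel₀ _ (by positivity)]
    linarith

/-- The quadrilateral inequality for `x`, `g ^ N • x`, `(g * h) ^ N • x`, `h ^ N • x`, divided by
`N ^ 2`, in the limit. -/
theorem Commute.translationLength_sq_add_le (hX : SatisfiesCN X) {g h : G} (hgh : Commute g h) :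
    translationLength (fun x : X => (g * h) • x) ^ 2 +
        translationLength (fun x : X => (g⁻¹ * h) • x) ^ 2 ≤
      2 * translationLength (fun x : X => g • x) ^ 2 +
        2 * translationLength (fun x : X => h • x) ^ 2 := by
  obtain ⟨x⟩ := ‹Nonempty X›
  have t := fun g : G => (tendsto_dist_pow_smul hX g x).pow 2
  refine le_of_tendsto_of_tendsto' ((t _).add (t _))
    (((t g).const_mul 2).add ((t h).const_mul 2)) fun k => ?_
  have hq := hX.quadrilateral x (g ^ 2 ^ k • x) ((g * h) ^ 2 ^ k • x) (h ^ 2 ^ k • x)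
  have h₁ : dist (g ^ 2 ^ k • x) ((g * h) ^ 2 ^ k • x) = dist x (h ^ 2 ^ k • x) := by
    rw [hgh.mul_pow, mul_smul, dist_smul]
  have h₂ : dist ((g * h) ^ 2 ^ k • x) (h ^ 2 ^ k • x) = dist x (g ^ 2 ^ k • x) := by
    rw [hgh.eq, hgh.symm.mul_pow, mul_smul, dist_smul, dist_comm]
  have h₃ : dist x ((g⁻¹ * h) ^ 2 ^ k • x) = dist (g ^ 2 ^ k • x) (h ^ 2 ^ k • x) := by
    rw [hgh.inv_left.mul_pow, mul_smul, ← dist_smul (g ^ 2 ^ k) x, inv_pow, smul_inv_smul]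
  rw [h₁, h₂, dist_comm (h ^ 2 ^ k • x) x] at hq
  rw [h₃]
  simp only [div_pow, ← add_div, ← mul_div_assoc]
  exact div_le_div_of_nonneg_right (by linarith) (by positivity)

theorem Commute.translationLength_parallelogram (hX : SatisfiesCN X) {g h : G}
    (hgh : Commute g h) :
    translationLength (fun x : X => (g * h) • x) ^ 2 +
        translationLength (fun x : X => (g⁻¹ * h) • x) ^ 2 =
      2 * translationLength (fun x : X => g • x) ^ 2 +
        2 * translationLength (fun x : X => h • x) ^ 2 := by
  refine le_antisymm (hgh.translationLength_sq_add_le hX) ?_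
  -- The reverse inequality is the same one for the pair `g * h`, `g⁻¹ * h`.
  have hc : Commute (g * h) (g⁻¹ * h) :=
    ((Commute.refl g).inv_right.mul_right hgh).mul_left (hgh.symm.inv_right.mul_right (.refl h))
  have key := hc.translationLength_sq_add_le hX
  have e₁ : g * h * (g⁻¹ * h) = h ^ 2 := by
    rw [hgh.eq, mul_assoc, mul_inv_cancel_left, pow_two]
  have e₂ : (g * h)⁻¹ * (g⁻¹ * h) = (g ^ 2)⁻¹ := by
    rw [hgh.inv_left.eq, mul_inv_rev, hgh.inv_inv.symm.eq]; group
  rw [e₁, e₂, translationLength_inv] at key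
  have l₁ := pow_le_pow_left₀ (by positivity [translationLength_nonneg (X := X) g])
    (two_mul_translationLength_le hX g) 2
  have l₂ := pow_le_pow_left₀ (by positivity [translationLength_nonneg (X := X) h])
    (two_mul_translationLength_le hX h) 2
  linarith

end TranslationLength

/-! ### The Busemann cocycle on the centralizer of a semisimple isometry -/

section BusemannCocycle

variable {G : Type*} [Group G] {X : Type*} [MetricSpace X] [MulAction G X]

/-- For `γ` translating an axis through `p` by `L = dist p (γ • p)`, the limit of
`dist p ((γ ^ N * h) • p) - N * L`, that is, the value at `h⁻¹ • p` of the Busemann function of the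
ray `p, γ • p, γ ^ 2 • p, …`. The sequence is antitone, so the limit is encoded as an
infimum. -/
noncomputable def busemannCocycle (γ : G) (p : X) (h : G) : ℝ :=
  ⨅ N : ℕ, (dist p ((γ ^ N * h) • p) - N * dist p (γ • p))

variable [IsIsometricSMul G X]

theorem dist_pow_smul_of_mem_minSet (hX : SatisfiesCN X) {γ : G} {p : X}
    (hp : p ∈ minSet (fun x : X => γ • x)) (n : ℕ) :
    dist p (γ ^ n • p) = n * dist p (γ • p) := by
  have : Nonempty X := ⟨p⟩
  refine (dist_pow_smul_le γ p n).antisymm ?_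
  -- Displacements along `γ ^ 2 ^ n` are known exactly; `γ ^ n` is the first part of that path.
  have hn : n ≤ 2 ^ n := Nat.lt_two_pow_self.le
  have h₁ := two_pow_mul_translationLength_le hX γ n
  have h₂ := translationLength_le (γ ^ 2 ^ n) p
  have h₃ := dist_triangle p (γ ^ n • p) (γ ^ 2 ^ n • p)
  have h₄ : dist (γ ^ n • p) (γ ^ 2 ^ n • p) = dist p (γ ^ (2 ^ n - n) • p) := by
    conv_lhs => rw [← Nat.add_sub_cancel' hn, pow_add, mul_smul, dist_smul]
  have h₅ := dist_pow_smul_le γ p (2 ^ n - n)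
  rw [← show dist p (γ • p) = _ from hp] at h₁
  rw [Nat.cast_sub hn] at h₅
  push_cast at h₅
  linarith

theorem tendsto_busemannCocycle (hX : SatisfiesCN X) {γ h : G} {p : X}
    (hp : p ∈ minSet (fun x : X => γ • x)) :
    Filter.Tendsto (fun N : ℕ => dist p ((γ ^ N * h) • p) - N * dist p (γ • p)) Filter.atTop
      (nhds (busemannCocycle γ p h)) := by
  refine tendsto_atTop_ciInf (antitone_nat_of_succ_le fun N => ?_) ⟨-dist p (h • p), ?_⟩
  · have h₁ := dist_triangle p (γ • p) ((γ ^ (N + 1) * h) • p)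
    rw [pow_succ', mul_assoc, mul_smul, dist_smul, ← mul_smul] at h₁
    rw [pow_succ', mul_assoc, mul_smul, ← mul_smul]
    push_cast
    linarith
  · rintro _ ⟨N, rfl⟩
    have h₁ := dist_triangle p ((γ ^ N * h) • p) (γ ^ N • p)
    rw [mul_smul, dist_smul, dist_comm (h • p), ← mul_smul,
      dist_pow_smul_of_mem_minSet hX hp] at h₁
    dsimp only
    linarith

theorem busemannCocycle_mul_le (hX : SatisfiesCN X) {γ g h : G} {p : X}
    (hp : p ∈ minSet (fun x : X => γ • x)) (hg : Commute γ g) :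
    busemannCocycle γ p (g * h) ≤ busemannCocycle γ p g + busemannCocycle γ p h := by
  refine le_of_tendsto_of_tendsto'
    ((tendsto_busemannCocycle hX hp).comp
      (Filter.tendsto_id.const_mul_atTop' two_pos))
    ((tendsto_busemannCocycle hX hp).add (tendsto_busemannCocycle hX hp)) fun N => ?_
  have h₁ := dist_triangle p ((γ ^ N * g) • p) ((γ ^ (2 * N) * (g * h)) • p)
  have h₂ : γ ^ (2 * N) * (g * h) = γ ^ N * g * (γ ^ N * h) := by
    rw [mul_assoc (γ ^ N) g, ← mul_assoc g, ← (hg.pow_left N).eq]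
    simp only [two_mul, pow_add, mul_assoc]
  rw [h₂, mul_smul (γ ^ N * g), dist_smul] at h₁
  simp only [Function.comp_apply, id]
  rw [h₂, mul_smul (γ ^ N * g)]
  push_cast
  linarith

/-- The Busemann functions of the two ends of the axis of `γ` through `p` are opposite on the
parallel axis through `h⁻¹ • p`. Writing `u` and `v` for the distances from `h⁻¹ • p` to
`γ ^ N • p` and to `γ ^ (-N) • p`, the quadrilateral inequality bounds `u ^ 2 + v ^ 2` by
`2 * (N * L) ^ 2` up to a constant, so that `u + v - 2 * N * L` is at most of order `1 / N`. -/
theorem busemannCocycle_add_inv_nonpos (hX : SatisfiesCN X) {γ h : G} {p : X}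
    (hp : p ∈ minSet (fun x : X => γ • x)) (hL : 0 < dist p (γ • p)) (hh : Commute γ h) :
    busemannCocycle γ p h + busemannCocycle γ p h⁻¹ ≤ 0 := by
  have hlim : Filter.Tendsto (fun N : ℕ => dist p (h • p) ^ 2 / dist p (γ • p) / N) Filter.atTop
      (nhds 0) := tendsto_const_nhds.div_atTop tendsto_natCast_atTop_atTop
  refine le_of_tendsto_of_tendsto
    ((tendsto_busemannCocycle hX hp).add (tendsto_busemannCocycle hX hp)) hlim ?_
  filter_upwards [Filter.eventually_gt_atTop 0] with N hN
  have hN' : (0 : ℝ) < N := Nat.cast_pos.2 hN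
  have hq := hX.quadrilateral (h • p) ((γ ^ N * h) • p) (γ ^ N • p) p
  have h₁ : dist ((γ ^ N * h) • p) (γ ^ N • p) = dist p (h • p) := by
    rw [mul_smul, dist_smul, dist_comm]
  have h₂ : dist (h • p) ((γ ^ N * h) • p) = N * dist p (γ • p) := by
    rw [(hh.pow_left N).eq, mul_smul, dist_smul, dist_pow_smul_of_mem_minSet hX hp]
  have h₃ : dist p ((γ ^ N * h⁻¹) • p) = dist (h • p) (γ ^ N • p) := by
    rw [(hh.pow_left N).inv_right.eq, mul_smul, ← dist_smul h, smul_inv_smul]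
  rw [h₁, h₂, dist_comm (γ ^ N • p) p, dist_pow_smul_of_mem_minSet hX hp, ← h₃,
    dist_comm ((γ ^ N * h) • p) p] at hq
  rw [le_div_iff₀ hN', le_div_iff₀ hL]
  nlinarith [sq_nonneg (dist p ((γ ^ N * h) • p) - N * dist p (γ • p)),
    sq_nonneg (dist p ((γ ^ N * h⁻¹) • p) - N * dist p (γ • p))]

theorem busemannCocycle_nonpos_of_commutator (hX : SatisfiesCN X) {γ u v δ : G} {p : X}
    (hp : p ∈ minSet (fun x : X => γ • x)) (hL : 0 < dist p (γ • p))
    (hu : Commute γ u) (hv : Commute γ v) (hδ : v * u = u * v * δ) :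
    busemannCocycle γ p δ ≤ 0 := by
  obtain rfl : δ = v⁻¹ * u⁻¹ * (v * u) := by rw [hδ]; group
  have h₁ := busemannCocycle_mul_le hX hp (h := v * u) (hv.inv_right.mul_right hu.inv_right)
  have h₂ := busemannCocycle_mul_le hX hp (h := u⁻¹) hv.inv_right
  have h₃ := busemannCocycle_mul_le hX hp (h := u) hv
  have h₄ := busemannCocycle_add_inv_nonpos hX hp hL hu
  have h₅ := busemannCocycle_add_inv_nonpos hX hp hL hv
  linarith

/-- The parallelogram law determines the quadratic function `N ↦ |γ ^ N * δ| ^ 2`, whose leading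
coefficient is `|γ| ^ 2`, from its equal values at `-1` and `0`. -/
theorem translationLength_pow_mul_sq (hX : SatisfiesCN X) [Nonempty X] {γ δ : G}
    (hc : Commute γ δ)
    (h : translationLength (fun x : X => (γ⁻¹ * δ) • x) = translationLength (fun x : X => δ • x))
    (N : ℕ) :
    translationLength (fun x : X => (γ ^ N * δ) • x) ^ 2 =
      translationLength (fun x : X => δ • x) ^ 2 +
        (N ^ 2 + N) * translationLength (fun x : X => γ • x) ^ 2 := by
  induction N using Nat.twoStepInduction with
  | zero => simp
  | one =>
    have := hc.translationLength_parallelogram hX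
    rw [h] at this
    simp only [pow_one, Nat.cast_one]
    linarith
  | more N ih₀ ih₁ =>
    have key := ((Commute.self_pow γ (N + 1)).mul_right hc).translationLength_parallelogram hX
    have e₁ : γ * (γ ^ (N + 1) * δ) = γ ^ (N + 2) * δ := by rw [← mul_assoc, ← pow_succ']
    have e₂ : γ⁻¹ * (γ ^ (N + 1) * δ) = γ ^ N * δ := by
      rw [pow_succ', mul_assoc, inv_mul_cancel_left]
    rw [e₁, e₂, ih₀, ih₁] at key
    push_cast at key ⊢
    linarith

/-- If `γ` had translation length `L > 0`, then `δ`, being a commutator in the centralizer of `γ`,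
would not move along the axes of `γ`, so that `|γ⁻¹ * δ| ^ 2 = |δ| ^ 2 + L ^ 2`; but `γ⁻¹ * δ` is
conjugate to `δ`. -/
theorem exists_smul_eq_of_commutator_of_conj (hX : SatisfiesCN X) {γ δ u v s : G}
    (hγ : (minSet (fun x : X => γ • x)).Nonempty) (hu : Commute γ u) (hv : Commute γ v)
    (hδ : v * u = u * v * δ) (hs : γ * s * δ = δ * s) : ∃ x : X, γ • x = x := by
  obtain ⟨p, hp⟩ := hγ
  have : Nonempty X := ⟨p⟩
  by_contra! hfix
  have hL : 0 < dist p (γ • p) := dist_pos.2 (hfix p).symm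
  have hc : Commute γ δ := by
    obtain rfl : δ = v⁻¹ * u⁻¹ * (v * u) := by rw [hδ]; group
    exact (hv.inv_right.mul_right hu.inv_right).mul_right (hv.mul_right hu)
  have hconj : translationLength (fun x : X => (γ⁻¹ * δ) • x) =
      translationLength (fun x : X => δ • x) := by
    have : γ⁻¹ * δ = s * δ * s⁻¹ := by
      rw [eq_mul_inv_iff_mul_eq, mul_assoc, ← hs]; group
    rw [this, translationLength_conj]
  have hlim := tendsto_busemannCocycle hX hp (h := δ)
  have hτ := busemannCocycle_nonpos_of_commutator hX hp hL hu hv hδ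
  set L := dist p (γ • p) with hLdef
  set a : ℕ → ℝ := fun N => dist p ((γ ^ N * δ) • p) - N * L with ha
  -- From `N ^ 2 L ^ 2 + N L ^ 2 ≤ |γ ^ N * δ| ^ 2 ≤ (N L + a N) ^ 2`, divided by `N`.
  have hle : ∀ᶠ N : ℕ in Filter.atTop, L ^ 2 ≤ 2 * L * a N + a N ^ 2 / N := by
    filter_upwards [Filter.eventually_gt_atTop 0] with N hN
    have hN' : (0 : ℝ) < N := Nat.cast_pos.2 hN
    have h₁ := translationLength_pow_mul_sq hX hc hconj N
    have h₂ := pow_le_pow_left₀ (translationLength_nonneg _) (translationLength_le (γ ^ N * δ) p) 2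
    have h₃ : dist p ((γ ^ N * δ) • p) = N * L + a N := by simp [ha]
    rw [h₁, h₃, ← show L = _ from hp] at h₂
    rw [← sub_le_iff_le_add', le_div_iff₀ hN']
    nlinarith [sq_nonneg (translationLength (fun x : X => δ • x))]
  have hlim₂ : Filter.Tendsto (fun N : ℕ => 2 * L * a N + a N ^ 2 / N) Filter.atTop
      (nhds (2 * L * busemannCocycle γ p δ + 0)) :=
    (hlim.const_mul _).add ((hlim.pow 2).div_atTop tendsto_natCast_atTop_atTop)
  have := ge_of_tendsto hlim₂ hle
  nlinarith

end BusemannCocycle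

/-! ### Relations between Nielsen transformations -/

section Nielsen

variable {ι : Type*} {F : Type*} [Group F] (b : FreeGroupBasis ι F)

theorem FreeGroupBasis.mulAut_ext {f g : MulAut F} (h : ∀ k, f (b k) = g (b k)) : f = g :=
  MulEquiv.toMonoidHom_injective (b.ext_hom _ _ h)

variable [DecidableEq ι]

theorem leftNielsen_apply (i j : ι) (hij : i ≠ j) (k : ι) :
    leftNielsen b i j hij (b k) = if k = i then b j * b i else b k := by
  simp [leftNielsen, Function.update_apply]

theorem rightNielsen_apply (i j : ι) (hij : i ≠ j) (k : ι) :
    rightNielsen b i j hij (b k) = if k = i then b i * b j else b k := by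
  simp [rightNielsen, Function.update_apply]

variable {i j k l : ι}

theorem commute_leftNielsen_rightNielsen (hij : i ≠ j) (hkl : k ≠ l) (hik : i ≠ k) (hil : i ≠ l)
    (hjk : j ≠ k) : Commute (leftNielsen b i j hij) (rightNielsen b k l hkl) := by
  refine b.mulAut_ext fun m => ?_
  rcases eq_or_ne m i with rfl | hmi
  · simp [leftNielsen_apply, rightNielsen_apply, *]
  · rcases eq_or_ne m k with rfl | hmk
    · simp [leftNielsen_apply, rightNielsen_apply, *, hil.symm]
    · simp [leftNielsen_apply, rightNielsen_apply, *]

theorem leftNielsen_mul_leftNielsen (hkl : k ≠ l) (hlj : l ≠ j) (hkj : k ≠ j) :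
    leftNielsen b l j hlj * leftNielsen b k l hkl =
      leftNielsen b k l hkl * leftNielsen b l j hlj * leftNielsen b k j hkj := by
  refine b.mulAut_ext fun m => ?_
  rcases eq_or_ne m k with rfl | hmk
  · simp [leftNielsen_apply, *, hkj.symm, hlj.symm, mul_assoc]
  · rcases eq_or_ne m l with rfl | hml
    · simp [leftNielsen_apply, *, hkj.symm]
    · simp [leftNielsen_apply, *]

theorem rightNielsen_mul_rightNielsen (hkl : k ≠ l) (hlj : l ≠ j) (hkj : k ≠ j) :
    rightNielsen b l j hlj * rightNielsen b k l hkl =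
      rightNielsen b k l hkl * rightNielsen b l j hlj * rightNielsen b k j hkj := by
  refine b.mulAut_ext fun m => ?_
  rcases eq_or_ne m k with rfl | hmk
  · simp [rightNielsen_apply, *, hkj.symm, hlj.symm, mul_assoc]
  · rcases eq_or_ne m l with rfl | hml
    · simp [rightNielsen_apply, *, hkj.symm]
    · simp [rightNielsen_apply, *]

theorem leftNielsen_mul_leftNielsen_mul_rightNielsen (hij : i ≠ j) (hik : i ≠ k) (hkj : k ≠ j) :
    leftNielsen b i j hij * leftNielsen b i k hik * rightNielsen b k j hkj =
      rightNielsen b k j hkj * leftNielsen b i k hik := by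
  refine b.mulAut_ext fun m => ?_
  rcases eq_or_ne m i with rfl | hmi
  · simp [leftNielsen_apply, rightNielsen_apply, *, hik.symm, mul_assoc]
  · rcases eq_or_ne m k with rfl | hmk
    · simp [leftNielsen_apply, rightNielsen_apply, *, hij.symm]
    · simp [leftNielsen_apply, rightNielsen_apply, *]

theorem rightNielsen_mul_rightNielsen_mul_leftNielsen (hij : i ≠ j) (hik : i ≠ k) (hkj : k ≠ j) :
    rightNielsen b i j hij * rightNielsen b i k hik * leftNielsen b k j hkj =
      leftNielsen b k j hkj * rightNielsen b i k hik := by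
  refine b.mulAut_ext fun m => ?_
  rcases eq_or_ne m i with rfl | hmi
  · simp [leftNielsen_apply, rightNielsen_apply, *, hik.symm, mul_assoc]
  · rcases eq_or_ne m k with rfl | hmk
    · simp [leftNielsen_apply, rightNielsen_apply, *, hij.symm]
    · simp [leftNielsen_apply, rightNielsen_apply, *]

end Nielsen

/-! ### Fixed points of Nielsen transformations -/

theorem theorem1p1 {n : ℕ} (hn : 4 ≤ n) {F : Type v} [Group F] (b : FreeGroupBasis (Fin n) F)
    {X : Type u} [MetricSpace X] [CompleteSpace X] (hX : IsCAT0 X)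
    [MulAction (MulAut F) X] (hact : ActsBySemisimpleIsometries (MulAut F) X)
    (i j : Fin n) (hij : i ≠ j) :
    (∃ x : X, leftNielsen b i j hij • x = x) ∧ (∃ x : X, rightNielsen b i j hij • x = x) := by
  have : IsIsometricSMul (MulAut F) X := ⟨fun g => (hact g).1⟩
  obtain ⟨k, hk⟩ : ∃ k, k ∉ ({i, j} : Finset (Fin n)) := by
    by_contra! h
    have := (Finset.card_le_card fun a _ => h a : Finset.univ.card ≤ _).trans Finset.card_le_two
    simp at this
    omega
  obtain ⟨l, hl⟩ : ∃ l, l ∉ ({i, j, k} : Finset (Fin n)) := by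
    by_contra! h
    have := (Finset.card_le_card fun a _ => h a : Finset.univ.card ≤ _).trans Finset.card_le_three
    simp at this
    omega
  simp only [Finset.mem_insert, Finset.mem_singleton, not_or] at hk hl
  obtain ⟨hki, hkj⟩ := hk
  obtain ⟨hli, hlj, hlk⟩ := hl
  exact ⟨exists_smul_eq_of_commutator_of_conj hX.satisfiesCN (hact _).2
      (commute_leftNielsen_rightNielsen b hij (Ne.symm hlk) (Ne.symm hki) (Ne.symm hli)
        (Ne.symm hkj))
      (commute_leftNielsen_rightNielsen b hij hlj (Ne.symm hli) hij (Ne.symm hlj))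
      (rightNielsen_mul_rightNielsen b (Ne.symm hlk) hlj hkj)
      (leftNielsen_mul_leftNielsen_mul_rightNielsen b hij (Ne.symm hki) hkj),
    exists_smul_eq_of_commutator_of_conj hX.satisfiesCN (hact _).2
      (commute_leftNielsen_rightNielsen b (Ne.symm hlk) hij hki hkj hli).symm
      (commute_leftNielsen_rightNielsen b hlj hij hli hlj (Ne.symm hij)).symm
      (leftNielsen_mul_leftNielsen b (Ne.symm hlk) hlj hkj)
      (rightNielsen_mul_rightNielsen_mul_leftNielsen b hij (Ne.symm hki) hkj)⟩
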